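/- Let $n\ge 1$. Let $\mathcal X_n$ be the real vector space of quaternionic hermitian $n\times n$ matrices ($\bar W'=W$, where the bar is quaternionic conjugation and the prime is the transpose) and let $\mathcal Z_n=\mathcal X_n\otimes_{\mathbb R}\mathbb C$. The group $\mathrm{GL}(n,\mathbb H)$ acts on $\mathcal Z_n$ by the complex linear extension $\varrho(U)$ of $W\mapsto UW\bar U'$, $W\in\mathcal X_n$. Embed $\mathrm{GL}(n,\mathbb H)$ into $\mathrm{GL}(2n,\mathbb C)$, $U\mapsto\check U$, by replacing each entry $x_0+x_1i_1+x_2i_2+x_3i_3$ by the block $$\begin{pmatrix}x_0+ix_1&x_2+ix_3\\-x_2+ix_3&x_0-ix_1\end{pmatrix}.$$ Then there is a unique rational representation $\varrho_{\mathrm{Jac}}:\mathrm{GL}(2n,\mathbb C)\to\mathrm{GL}(\mathcal Z_n)$ with $\varrho_{\mathrm{Jac}}(\check U)=\varrho(U)$ for all $U\in\mathrm{GL}(n,\mathbb H)$ (rational: every matrix coefficient is a polynomial in the entries divided by a power of the determinant). One has $\dim_{\mathbb C}\mathcal Z_n=n+2n(n-1)$. The representation $\varrho_{\mathrm{Jac}}$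 is irreducible, and its highest weight is $(1,1,0,\dots,0)$. That is, there are nonzero vectors of $\mathcal Z_n$ fixed by all unipotent upper triangular matrices, and each invertible diagonal matrix with diagonal entries $d_1,\dots,d_{2n}$ acts on every such vector by multiplication by $d_1d_2$. -/

import Mathlib

open scoped Quaternion TensorProduct

noncomputable section

namespace QuatJac

/-- The embedding `x ↦ x̌` of the real quaternions into the complex `2 × 2` matrices,
`x₀ + x₁ i₁ + x₂ i₂ + x₃ i₃ ↦ (x₀ + i x₁, x₂ + i x₃; -x₂ + i x₃, x₀ - i x₁)`. -/
def check : ℍ[ℝ] →+* Matrix (Fin 2) (Fin 2) ℂ where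
  toFun x := !![⟨x.re, x.imI⟩, ⟨x.imJ, x.imK⟩; ⟨-x.imJ, x.imK⟩, ⟨x.re, -x.imI⟩]
  map_one' := by
    ext i j; fin_cases i <;> fin_cases j <;> apply Complex.ext <;> simp
  map_mul' x y := by
    ext i j; fin_cases i <;> fin_cases j <;> apply Complex.ext <;>
      simp [Matrix.mul_apply, Fin.sum_univ_two] <;> ring
  map_zero' := by
    ext i j; fin_cases i <;> fin_cases j <;> apply Complex.ext <;> simp
  map_add' x y := by
    ext i j; fin_cases i <;> fin_cases j <;> apply Complex.ext <;> simp <;> ring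

/-- Row `a` of the `i`-th block of size two is row number `2 i + a` (counting from zero). -/
def blockIndex (n : ℕ) : Fin n × Fin 2 ≃ Fin (2 * n) :=
  finProdFinEquiv.trans (finCongr (Nat.mul_comm n 2))

/-- The entrywise extension `A ↦ Ǎ` to a ring homomorphism from quaternionic `n × n` matrices
to complex `2n × 2n` matrices. -/
def checkMatrix (n : ℕ) :
    Matrix (Fin n) (Fin n) ℍ[ℝ] →+* Matrix (Fin (2 * n)) (Fin (2 * n)) ℂ :=
  (Matrix.reindexRingEquiv ℂ (blockIndex n)).toRingHom.comp
    ((Matrix.compRingEquiv (Fin n) (Fin 2) ℂ).toRingHom.comp check.mapMatrix)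

/-- The embedding `GL(n, ℍ) → GL(2n, ℂ)`, `U ↦ Ǔ`. -/
def checkGL (n : ℕ) :
    Matrix.GeneralLinearGroup (Fin n) ℍ[ℝ] →* Matrix.GeneralLinearGroup (Fin (2 * n)) ℂ :=
  Units.map (checkMatrix n : Matrix (Fin n) (Fin n) ℍ[ℝ] →*
    Matrix (Fin (2 * n)) (Fin (2 * n)) ℂ)

/-- `𝒳ₙ`: the real vector space of quaternionic hermitian `n × n` matrices. -/
def HermX (n : ℕ) : Submodule ℝ (Matrix (Fin n) (Fin n) ℍ[ℝ]) where
  carrier := {W | W.IsHermitian}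
  add_mem' hV hW := hV.add hW
  zero_mem' := Matrix.isHermitian_zero
  smul_mem' c W hW := by
    ext1 i j
    have h := Matrix.IsHermitian.apply hW i j
    simp only [Matrix.conjTranspose_apply, Matrix.smul_apply, Quaternion.star_smul, h]

/-- `𝒵ₙ = 𝒳ₙ ⊗_ℝ ℂ`, as a complex vector space. -/
abbrev ComplexZ (n : ℕ) : Type := ℂ ⊗[ℝ] HermX n

/-- The real linear map `W ↦ U W Ū'` of `𝒳ₙ`. -/
def conjX (n : ℕ) (U : Matrix (Fin n) (Fin n) ℍ[ℝ]) : HermX n →ₗ[ℝ] HermX n where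
  toFun W := ⟨U * W.1 * U.conjTranspose, Matrix.isHermitian_mul_mul_conjTranspose U W.2⟩
  map_add' V W := by
    apply Subtype.ext
    simp [mul_add, add_mul]
  map_smul' c W := by
    apply Subtype.ext
    simp

/-- The representation `ϱ(U) : W ↦ U W Ū'` of `GL(n, ℍ)` on `𝒵ₙ`
(the complex linear extension of the action on `𝒳ₙ`). -/
def rho (n : ℕ) : Matrix.GeneralLinearGroup (Fin n) ℍ[ℝ] →* (ComplexZ n →ₗ[ℂ] ComplexZ n) where
  toFun U := (conjX n U.1).baseChange ℂ
  map_one' := by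
    have h : conjX n ((1 : Matrix.GeneralLinearGroup (Fin n) ℍ[ℝ]) :
        Matrix (Fin n) (Fin n) ℍ[ℝ]) = LinearMap.id := by
      ext1 W
      apply Subtype.ext
      simp [conjX]
    rw [h]
    exact LinearMap.baseChange_id
  map_mul' U V := by
    have h : conjX n ((U * V : Matrix.GeneralLinearGroup (Fin n) ℍ[ℝ]) :
        Matrix (Fin n) (Fin n) ℍ[ℝ]) = (conjX n U.1).comp (conjX n V.1) := by
      ext1 W
      apply Subtype.ext
      simp [conjX, Matrix.conjTranspose_mul, mul_assoc]
    rw [h]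
    exact LinearMap.baseChange_comp _ _

/-- A representation of `GL(N, ℂ)` is rational if each of its matrix coefficients is a polynomial
in the entries of the group element divided by a power of the determinant. -/
def IsRational {N : ℕ} {V : Type*} [AddCommGroup V] [Module ℂ V]
    (σ : Representation ℂ (Matrix.GeneralLinearGroup (Fin N) ℂ) V) : Prop :=
  ∀ (l : Module.Dual ℂ V) (v : V), ∃ (p : MvPolynomial (Fin N × Fin N) ℂ) (k : ℕ),
    ∀ g : Matrix.GeneralLinearGroup (Fin N) ℂ,
      l (σ g v) = MvPolynomial.eval (fun ij => g.1 ij.1 ij.2) p / (g.1.det) ^ k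

/-- The property that characterizes `ϱ_Jac`: it is a rational representation of `GL(2n, ℂ)`
on `𝒵ₙ` with `ϱ_Jac(Ǔ) = ϱ(U)` for all `U ∈ GL(n, ℍ)`. -/
structure IsJac (n : ℕ)
    (σ : Representation ℂ (Matrix.GeneralLinearGroup (Fin (2 * n)) ℂ) (ComplexZ n)) : Prop where
  rational : IsRational σ
  extends_rho : ∀ U : Matrix.GeneralLinearGroup (Fin n) ℍ[ℝ], σ (checkGL n U) = rho n U

/-- A highest weight vector: a nonzero vector that is invariant under all unipotent upper
triangular matrices. -/
def IsHighestWeightVector {N : ℕ} {V : Type*} [AddCommGroup V] [Module ℂ V]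
    (σ : Representation ℂ (Matrix.GeneralLinearGroup (Fin N) ℂ) V) (v : V) : Prop :=
  v ≠ 0 ∧ ∀ g : Matrix.GeneralLinearGroup (Fin N) ℂ,
    g.1.IsUpperTriangular → (∀ i, g.1 i i = 1) → σ g v = v

/-- The vector `v` has weight `w`: each invertible diagonal matrix `diag(d₁, …, d_N)` multiplies
it by `d₁ ^ w₁ ⋯ d_N ^ w_N`. -/
def HasWeight {N : ℕ} {V : Type*} [AddCommGroup V] [Module ℂ V]
    (σ : Representation ℂ (Matrix.GeneralLinearGroup (Fin N) ℂ) V) (v : V) (w : Fin N → ℤ) :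
    Prop :=
  ∀ (g : Matrix.GeneralLinearGroup (Fin N) ℂ) (d : Fin N → ℂ),
    g.1 = Matrix.diagonal d → σ g v = (∏ i, d i ^ w i) • v

/-- `w` is the highest weight of `σ`: highest weight vectors exist, and all of them have
weight `w`. -/
def IsHighestWeight {N : ℕ} {V : Type*} [AddCommGroup V] [Module ℂ V]
    (σ : Representation ℂ (Matrix.GeneralLinearGroup (Fin N) ℂ) V) (w : Fin N → ℤ) : Prop :=
  (∃ v, IsHighestWeightVector σ v) ∧ ∀ v, IsHighestWeightVector σ v → HasWeight σ v w

end QuatJac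

end

noncomputable section

namespace QuatJac

/-! ### Polynomial functions on matrices -/

/-! Complex `2n × 2n` matrices are the complexification of the quaternionic `n × n` matrices: each
is uniquely `Ǎ + i B̌`. If `J` is the scalar matrix of the quaternion `i₂`, then transposing `Ǎ`
corresponds to `A ↦ J⁻¹ Ā' J`. Hence `W` is hermitian exactly when the image of `W J` is
skew-symmetric, and `W ↦ U W Ū'` turns into `S ↦ Ǔ S Ǔ'` (`hermToSkew_conjX`). So `𝒵ₙ` is the space
of skew matrices, and `S ↦ g S g'`, the second exterior power of the standard representation, is the
required extension.

Uniqueness holds because `GL(n, ℍ)` is Zariski dense in the complex matrices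
(`eq_zero_of_eval_checkGL`). For irreducibility, a stable subspace is by density also stable under
singular matrices, and rank two matrices carry any nonzero `S` to multiples of all `E_{ij} -
E_{ji}`. The highest weight vectors are found by testing invariance on `1 + E_{ij}`, which leaves
only the line of `e₁ ∧ e₂`. -/

theorem eval_det_mvPolynomialX {N : ℕ} (x : Fin N × Fin N → ℂ) :
    MvPolynomial.eval x (Matrix.mvPolynomialX (Fin N) (Fin N) ℂ).det =
      (Matrix.of fun i j => x (i, j)).det := by
  rw [RingHom.map_det]
  congr 1
  ext i j
  simp

theorem eq_zero_of_eval_mul_det {N : ℕ} {p : MvPolynomial (Fin N × Fin N) ℂ}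
    (h : ∀ M : Matrix (Fin N) (Fin N) ℂ,
      MvPolynomial.eval (fun ij => M ij.1 ij.2) p * M.det = 0) : p = 0 := by
  have hdet : p * (Matrix.mvPolynomialX (Fin N) (Fin N) ℂ).det = 0 := by
    apply MvPolynomial.funext
    intro x
    rw [map_mul, eval_det_mvPolynomialX, map_zero]
    exact h (Matrix.of fun i j => x (i, j))
  exact (mul_eq_zero.mp hdet).resolve_right (Matrix.det_mvPolynomialX_ne_zero _ _)

/-- A polynomial in the matrix entries that vanishes on all invertible matrices is zero. -/
theorem eq_zero_of_eval_GL {N : ℕ} {p : MvPolynomial (Fin N × Fin N) ℂ}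
    (h : ∀ g : Matrix.GeneralLinearGroup (Fin N) ℂ,
      MvPolynomial.eval (fun ij => g.1 ij.1 ij.2) p = 0) : p = 0 := by
  refine eq_zero_of_eval_mul_det fun M => ?_
  by_cases hd : M.det = 0
  · rw [hd, mul_zero]
  · have hM : MvPolynomial.eval (fun ij => M ij.1 ij.2) p = 0 :=
      h (Matrix.GeneralLinearGroup.mkOfDetNeZero M hd)
    rw [hM, zero_mul]

/-! ### Skew-symmetric matrices -/

/-- The space of skew-symmetric complex matrices. -/
def skew (N : ℕ) : Submodule ℂ (Matrix (Fin N) (Fin N) ℂ) where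
  carrier := {S | S.transpose = -S}
  add_mem' {S T} hS hT := by
    simp only [Set.mem_ofPred_eq] at hS hT ⊢
    rw [Matrix.transpose_add, hS, hT, neg_add]
  zero_mem' := by simp
  smul_mem' c S hS := by
    simp only [Set.mem_ofPred_eq] at hS ⊢
    rw [Matrix.transpose_smul, hS, smul_neg]

theorem mem_skew {N : ℕ} {S : Matrix (Fin N) (Fin N) ℂ} : S ∈ skew N ↔ S.transpose = -S := Iff.rfl

theorem skew_apply {N : ℕ} (S : skew N) (i j : Fin N) : S.1 j i = -S.1 i j :=
  congrFun (congrFun (mem_skew.mp S.2) i) j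

theorem skew_apply_self {N : ℕ} (S : skew N) (i : Fin N) : S.1 i i = 0 :=
  self_eq_neg.mp (skew_apply S i i)

/-- A skew-symmetric matrix is determined by its entries above the diagonal. -/
def skewEquiv (N : ℕ) : skew N ≃ₗ[ℂ] ({x : Fin N × Fin N // x.1 < x.2} → ℂ) where
  toFun S x := S.1 x.1.1 x.1.2
  map_add' _ _ := rfl
  map_smul' _ _ := rfl
  invFun f := ⟨Matrix.of fun i j =>
    if h : i < j then f ⟨(i, j), h⟩ else if h : j < i then -f ⟨(j, i), h⟩ else 0, by
      rw [mem_skew]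
      ext i j
      rcases lt_trichotomy i j with h | h | h
      · simp [h, h.not_gt]
      · simp [h]
      · simp [h, h.not_gt]⟩
  left_inv S := by
    ext i j
    rcases lt_trichotomy i j with h | h | h
    · simp [h]
    · simp [h, skew_apply_self]
    · simp [h, h.not_gt, skew_apply S i j]
  right_inv f := by
    ext ⟨⟨i, j⟩, h⟩
    simp only at h
    simp [h]

theorem finrank_skew (N : ℕ) : Module.finrank ℂ (skew N) = N.choose 2 := by
  rw [(skewEquiv N).finrank_eq, Module.finrank_fintype_fun_eq_card, Fintype.card_subtype,
    Fintype.card_product_filter_lt, Fintype.card_fin]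

/-- The multiplicative map `M ↦ (S ↦ M S M')` on skew-symmetric matrices. -/
def skewConj (N : ℕ) : Matrix (Fin N) (Fin N) ℂ →* Module.End ℂ (skew N) where
  toFun M :=
    { toFun := fun S => ⟨M * S.1 * M.transpose, by
        rw [mem_skew, Matrix.transpose_mul, Matrix.transpose_mul, mem_skew.mp S.2,
          Matrix.transpose_transpose]
        simp [mul_assoc]⟩
      map_add' := fun S T => by
        apply Subtype.ext
        simp [mul_add, add_mul]
      map_smul' := fun c S => by
        apply Subtype.ext
        simp }
  map_one' := by
    ext1 S
    apply Subtype.ext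
    simp
  map_mul' M M' := by
    ext1 S
    apply Subtype.ext
    simp [mul_assoc]

@[simp]
theorem coe_skewConj {N : ℕ} (M : Matrix (Fin N) (Fin N) ℂ) (S : skew N) :
    (skewConj N M S).1 = M * S.1 * M.transpose := rfl

/-- The matrix coefficients of `skewConj` are polynomials in the entries. -/
theorem exists_eval_eq_skewConj {N : ℕ} (l : Module.Dual ℂ (skew N)) (S : skew N) :
    ∃ p : MvPolynomial (Fin N × Fin N) ℂ, ∀ M : Matrix (Fin N) (Fin N) ℂ,
      l (skewConj N M S) = MvPolynomial.eval (fun ij => M ij.1 ij.2) p := by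
  -- Extended to all matrices, the functional is a linear combination of the entries of `M S M'`,
  -- each of them quadratic in `M`.
  obtain ⟨L, hL⟩ := l.exists_extend
  let X := Matrix.mvPolynomialX (Fin N) (Fin N) ℂ
  refine ⟨∑ i, ∑ j, MvPolynomial.C (L (Matrix.single i j 1)) *
    (X * S.1.map (MvPolynomial.C (σ := Fin N × Fin N)) * X.transpose : Matrix (Fin N) (Fin N) _) i j,
      fun M => ?_⟩
  have h1 : l (skewConj N M S) = L (M * S.1 * M.transpose) := by
    rw [← hL]
    rfl
  rw [h1]
  conv_lhs => rw [Matrix.matrix_eq_sum_single (M * S.1 * M.transpose)]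
  simp only [map_sum, map_mul, MvPolynomial.eval_C]
  refine Finset.sum_congr rfl fun i _ => Finset.sum_congr rfl fun j _ => ?_
  have h2 : Matrix.single i j ((M * S.1 * M.transpose) i j) =
      (M * S.1 * M.transpose) i j • Matrix.single i j (1 : ℂ) := by simp
  rw [h2, map_smul, smul_eq_mul, mul_comm]
  congr 1
  simp [Matrix.mul_apply, X]

/-- The elementary skew-symmetric matrix `E_{ij} - E_{ji}`. -/
def wedge {N : ℕ} (i j : Fin N) : skew N :=
  ⟨Matrix.single i j 1 - Matrix.single j i 1, by
    rw [mem_skew, Matrix.transpose_sub, Matrix.transpose_single, Matrix.transpose_single, neg_sub]⟩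

/-- The factor `1/2` compensates for each pair occurring twice, as `(i, j)` and as `(j, i)`. -/
theorem eq_sum_wedge {N : ℕ} (S : skew N) :
    S = ∑ i, ∑ j, (S.1 i j / 2) • wedge i j := by
  apply Subtype.ext
  ext a b
  simp only [wedge, Submodule.coe_sum, Submodule.coe_smul, Matrix.sum_apply, Matrix.smul_apply,
    Matrix.sub_apply, smul_eq_mul, mul_sub, Finset.sum_sub_distrib, Matrix.single_apply]
  have h1 : ∀ f : Fin N → Fin N → ℂ, ∑ i, ∑ j, f i j * (if i = a ∧ j = b then 1 else 0) = f a b := by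
    intro f
    rw [Finset.sum_eq_single a, Finset.sum_eq_single b] <;> simp +contextual
  have h2 : ∀ f : Fin N → Fin N → ℂ, ∑ i, ∑ j, f i j * (if j = a ∧ i = b then 1 else 0) = f b a := by
    intro f
    rw [Finset.sum_eq_single b, Finset.sum_eq_single a] <;> simp +contextual
  rw [h1 fun i j => S.1 i j / 2, h2 fun i j => S.1 i j / 2, skew_apply S a b]
  ring

/-- Only the cross terms survive, since `S a a` and `S b b` vanish. One nonzero entry of `S` thus
produces every elementary skew matrix. -/
theorem skewConj_rank_two {N : ℕ} (S : skew N) (a b i j : Fin N) :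
    skewConj N (Matrix.single i a 1 + Matrix.single j b 1) S = S.1 a b • wedge i j := by
  apply Subtype.ext
  rw [coe_skewConj]
  simp only [Matrix.transpose_add, Matrix.transpose_single, add_mul, mul_add,
    Matrix.single_mul_mul_single, one_mul, mul_one, skew_apply_self, skew_apply S a b,
    Matrix.single_zero, wedge, Submodule.coe_smul, smul_sub, Matrix.smul_single, smul_eq_mul,
    ← Matrix.single_neg]
  abel

/-- A subspace of the skew-symmetric matrices that is stable under `skewConj` of all matrices is
trivial. -/
theorem eq_bot_or_eq_top_of_skewConj_mem {N : ℕ} {W : Submodule ℂ (skew N)}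
    (hW : ∀ (M : Matrix (Fin N) (Fin N) ℂ), ∀ S ∈ W, skewConj N M S ∈ W) : W = ⊥ ∨ W = ⊤ := by
  by_cases h : W = ⊥
  · exact Or.inl h
  right
  obtain ⟨S, hS, hS0⟩ := W.ne_bot_iff.mp h
  obtain ⟨a, b, hab⟩ : ∃ a b, S.1 a b ≠ 0 := by
    by_contra! hc
    exact hS0 (Subtype.ext (Matrix.ext hc))
  have hw : ∀ i j, wedge i j ∈ W := fun i j =>
    (W.smul_mem_iff hab).mp (skewConj_rank_two S a b i j ▸ hW _ S hS)
  refine (Submodule.eq_top_iff').mpr fun T => ?_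
  rw [eq_sum_wedge T]
  exact W.sum_mem fun i _ => W.sum_mem fun j _ => W.smul_mem _ (hw i j)

/-- Each functional that kills `W` gives a polynomial in `M` vanishing on invertible matrices, hence
everywhere. -/
theorem skewConj_mem_of_GL {N : ℕ} {W : Submodule ℂ (skew N)} {S : skew N}
    (hW : ∀ g : Matrix.GeneralLinearGroup (Fin N) ℂ, skewConj N g.1 S ∈ W)
    (M : Matrix (Fin N) (Fin N) ℂ) : skewConj N M S ∈ W := by
  rw [← Subspace.forall_mem_dualAnnihilator_apply_eq_zero_iff]
  intro l hl
  obtain ⟨p, hp⟩ := exists_eval_eq_skewConj l S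
  have hp0 : p = 0 := eq_zero_of_eval_GL fun g => by
    rw [← hp]
    exact (Submodule.mem_dualAnnihilator l).mp hl _ (hW g)
  rw [hp, hp0, map_zero]

/-! ### The second exterior power of the standard representation -/

variable {N : ℕ} {V : Type*} [AddCommGroup V] [Module ℂ V]

/-- The representation `S ↦ g S g'` on skew-symmetric matrices, transported along a linear
equivalence. -/
def skewRep (e : V ≃ₗ[ℂ] skew N) : Representation ℂ (Matrix.GeneralLinearGroup (Fin N) ℂ) V :=
  (e.symm.conjAlgEquiv ℂ : Module.End ℂ (skew N) →* Module.End ℂ V).comp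
    ((skewConj N).comp (Units.coeHom _))

theorem apply_skewRep (e : V ≃ₗ[ℂ] skew N) (g : Matrix.GeneralLinearGroup (Fin N) ℂ) (v : V) :
    e (skewRep e g v) = skewConj N g.1 (e v) := by
  simp [skewRep]

theorem isRational_skewRep (e : V ≃ₗ[ℂ] skew N) : IsRational (skewRep e) := by
  intro l v
  obtain ⟨p, hp⟩ := exists_eval_eq_skewConj (l.comp e.symm.toLinearMap) (e v)
  refine ⟨p, 0, fun g => ?_⟩
  rw [pow_zero, div_one, ← hp, ← apply_skewRep]
  simp

theorem isIrreducible_skewRep (hN : 2 ≤ N) (e : V ≃ₗ[ℂ] skew N) : (skewRep e).IsIrreducible := by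
  have hnt : Nontrivial (Subrepresentation (skewRep e)) := by
    refine ⟨⊥, ⊤, fun h => ?_⟩
    have h' : (⊥ : Submodule ℂ V) = ⊤ := congrArg Subrepresentation.toSubmodule h
    have : Subsingleton V := (Submodule.subsingleton_iff ℂ).mp (subsingleton_of_bot_eq_top h')
    have h0 := finrank_skew N
    rw [← e.finrank_eq, Module.finrank_zero_of_subsingleton] at h0
    exact (Nat.choose_pos hN).ne h0
  refine { eq_bot_or_eq_top := fun W => ?_ }
  have hW : ∀ (M : Matrix (Fin N) (Fin N) ℂ), ∀ S ∈ W.toSubmodule.map e.toLinearMap,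
      skewConj N M S ∈ W.toSubmodule.map e.toLinearMap := by
    rintro M _ ⟨w, hw, rfl⟩
    exact skewConj_mem_of_GL
      (fun g => Submodule.mem_map.mpr ⟨_, W.apply_mem_toSubmodule g hw, apply_skewRep e g w⟩) M
  refine (eq_bot_or_eq_top_of_skewConj_mem hW).imp (fun h => ?_) (fun h => ?_)
  · exact Subrepresentation.toSubmodule_injective 
      ((Submodule.map_eq_bot_iff (e := e)).mp h)
  · refine Subrepresentation.toSubmodule_injective ((Submodule.eq_top_iff').mpr fun v => ?_)
    obtain ⟨w, hw, hwv⟩ : e v ∈ W.toSubmodule.map e.toLinearMap := h ▸ Submodule.mem_top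
    exact e.injective hwv ▸ hw

/-- The entries of a skew-symmetric matrix that is invariant under the unipotent upper triangular
matrices vanish outside the first two rows and columns. -/
theorem skew_apply_eq_zero_of_invariant {S : skew N}
    (hS : ∀ g : Matrix.GeneralLinearGroup (Fin N) ℂ,
      g.1.IsUpperTriangular → (∀ i, g.1 i i = 1) → skewConj N g.1 S = S)
    {i j b : Fin N} (hij : i < j) (hib : i ≠ b) : S.1 j b = 0 := by
  have h0 : Matrix.single i j (1 : ℂ) * Matrix.single i j 1 = 0 :=
    Matrix.single_mul_single_of_ne (h := hij.ne') ..
  let g : Matrix.GeneralLinearGroup (Fin N) ℂ :=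
    ⟨1 + Matrix.single i j 1, 1 - Matrix.single i j 1, by simp [mul_sub, add_mul, h0],
      by simp [mul_add, sub_mul, h0]⟩
  -- For `i ≠ b` the `(i, b)` entry of `g S g'` is `S i b + S j b`, so invariance forces `S j b =
  -- 0`.
  have hg := congrArg (fun T : skew N => T.1 i b) (hS g ?_ ?_)
  · simp only [coe_skewConj, g, Matrix.transpose_add, Matrix.transpose_one,
      Matrix.transpose_single, add_mul, mul_add, one_mul, mul_one, Matrix.add_apply,
      Matrix.single_mul_mul_single, skew_apply_self] at hg
    simpa [hib, Matrix.single_mul_apply_same, Matrix.mul_single_apply_of_ne _ _ _ _ _ hib.symm]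
      using hg
  · intro a b hab
    have hab' : b < a := hab
    have : ¬(i = a ∧ j = b) := by
      rintro ⟨rfl, rfl⟩
      exact hij.not_gt hab'
    simp [g, this, hab'.ne']
  · intro a
    have : ¬(i = a ∧ j = a) := by
      rintro ⟨rfl, rfl⟩
      exact hij.ne rfl
    simp [g, this]

theorem isHighestWeight_skewRep (hN : 2 ≤ N) (e : V ≃ₗ[ℂ] skew N) :
    IsHighestWeight (skewRep e) (fun i => if i.val < 2 then 1 else 0) := by
  let i₀ : Fin N := ⟨0, by omega⟩
  let i₁ : Fin N := ⟨1, by omega⟩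
  have h01 : i₀ ≠ i₁ := by simp [i₀, i₁]
  constructor
  · refine ⟨e.symm (wedge i₀ i₁), ?_, fun g hg hg1 => ?_⟩
    · rw [Ne, LinearEquiv.map_eq_zero_iff]
      intro h
      have := congrArg (fun T : skew N => T.1 i₀ i₁) h
      simp [wedge, h01, h01.symm] at this
    · apply e.injective
      rw [apply_skewRep, LinearEquiv.apply_symm_apply]
      have hc : ∀ i, g.1 i i₀ = if i = i₀ then 1 else 0 := by
        intro i
        split_ifs with h
        · rw [h, hg1]
        · refine hg (show i₀ < i from ?_)
          simp only [Fin.lt_def, Fin.ext_iff, i₀] at h ⊢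
          omega
      have hc1 : ∀ i, i ≠ i₀ → g.1 i i₁ = if i = i₁ then 1 else 0 := by
        intro i hi
        split_ifs with h
        · rw [h, hg1]
        · refine hg (show i₁ < i from ?_)
          simp only [Fin.lt_def, Fin.ext_iff, i₀, i₁, Ne] at h hi ⊢
          omega
      apply Subtype.ext
      ext a b
      -- The entries are the `2 × 2` minors of the first two columns of `g`; the first column is
      -- `e₁`, the second `e₂` plus a multiple of `e₁`.
      have key : (skewConj N g.1 (wedge i₀ i₁)).1 a b =
          g.1 a i₀ * g.1 b i₁ - g.1 a i₁ * g.1 b i₀ := by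
        simp [wedge, mul_sub, sub_mul, Matrix.mul_apply, Matrix.single_apply, ite_and]
      rw [key, hc, hc]
      by_cases ha : a = i₀ <;> by_cases hb : b = i₀
      · subst ha hb
        simp [wedge, h01.symm]
      · rw [hc1 b hb]
        simp [wedge, Matrix.single_apply, ha, hb, h01.symm, eq_comm]
      · rw [hc1 a ha]
        simp [wedge, Matrix.single_apply, ha, hb, h01.symm, eq_comm]
      · simp [wedge, ha, hb, Ne.symm ha, Ne.symm hb, eq_comm]
  · rintro v ⟨-, hv⟩ g d hgd
    have hS : ∀ g : Matrix.GeneralLinearGroup (Fin N) ℂ,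
        g.1.IsUpperTriangular → (∀ i, g.1 i i = 1) → skewConj N g.1 (e v) = e v := fun g h h' => by
      rw [← apply_skewRep, hv g h h']
    have hz : ∀ a b : Fin N, 2 ≤ a.val → (e v).1 a b = 0 := by
      intro a b ha
      -- Either of the first two rows may serve as `i`; it only has to differ from `b`.
      by_cases hb : b = i₀
      · exact skew_apply_eq_zero_of_invariant (i := i₁) hS (by simp [Fin.lt_def, i₁]; omega)
          (hb ▸ h01.symm)
      · exact skew_apply_eq_zero_of_invariant (i := i₀) hS (by simp [Fin.lt_def, i₀]; omega)
          (Ne.symm hb)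
    have hprod : ∏ i, d i ^ (if i.val < 2 then (1 : ℤ) else 0) = d i₀ * d i₁ := by
      rw [← Finset.prod_subset (Finset.subset_univ {i₀, i₁}), Finset.prod_pair h01]
      · simp [i₀, i₁]
      · intro i _ hi
        have : ¬ i.val < 2 := by
          simp only [Finset.mem_insert, Finset.mem_singleton, Fin.ext_iff, i₀, i₁] at hi
          omega
        simp [this]
    apply e.injective
    rw [apply_skewRep, map_smul, hprod]
    apply Subtype.ext
    ext a b
    rw [coe_skewConj, hgd, Matrix.diagonal_transpose, Matrix.mul_diagonal, Matrix.diagonal_mul,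
      Submodule.coe_smul, Matrix.smul_apply, smul_eq_mul]
    by_cases ha : 2 ≤ a.val
    · simp [hz a b ha]
    by_cases hb : 2 ≤ b.val
    · simp [skew_apply (e v) b a, hz b a hb]
    have hcases : ∀ c : Fin N, ¬ 2 ≤ c.val → c = i₀ ∨ c = i₁ := fun c hc => by
      simp only [Fin.ext_iff, i₀, i₁]
      omega
    by_cases hab : a = b
    · rw [hab, skew_apply_self, mul_zero, zero_mul, mul_zero]
    rcases hcases a ha with ha | ha <;> rcases hcases b hb with hb | hb
    · exact absurd (ha.trans hb.symm) hab
    · rw [ha, hb]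
      ring
    · rw [ha, hb]
      ring
    · exact absurd (ha.trans hb.symm) hab

/-! ### The complexification of the quaternionic matrices -/

/-- The witnesses solve the real linear system that splits `M₂(ℂ)` as `ℍ ⊕ iℍ`. -/
theorem exists_eq_check_add (m : Matrix (Fin 2) (Fin 2) ℂ) :
    ∃ a b : ℍ[ℝ], m = check a + Complex.I • check b := by
  refine ⟨⟨((m 0 0).re + (m 1 1).re) / 2, ((m 0 0).im - (m 1 1).im) / 2,
      ((m 0 1).re - (m 1 0).re) / 2, ((m 0 1).im + (m 1 0).im) / 2⟩,
    ⟨((m 0 0).im + (m 1 1).im) / 2, ((m 1 1).re - (m 0 0).re) / 2,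
      ((m 0 1).im - (m 1 0).im) / 2, -((m 0 1).re + (m 1 0).re) / 2⟩, ?_⟩
  ext i j
  fin_cases i <;> fin_cases j <;> apply Complex.ext <;> simp [check] <;> ring

theorem check_add_inj {a b a' b' : ℍ[ℝ]}
    (h : check a + Complex.I • check b = check a' + Complex.I • check b') : a = a' ∧ b = b' := by
  have h00 := congrFun (congrFun h 0) 0
  have h01 := congrFun (congrFun h 0) 1
  have h10 := congrFun (congrFun h 1) 0
  have h11 := congrFun (congrFun h 1) 1
  simp [check, Complex.ext_iff] at h00 h01 h10 h11
  constructor <;> ext <;> linarith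

theorem checkMatrix_apply (n : ℕ) (A : Matrix (Fin n) (Fin n) ℍ[ℝ]) (i j : Fin n) (a b : Fin 2) :
    checkMatrix n A (blockIndex n (i, a)) (blockIndex n (j, b)) = check (A i j) a b := by
  simp only [checkMatrix, RingHom.comp_apply, RingEquiv.toRingHom_eq_coe, RingHom.coe_coe,
    Matrix.compRingEquiv_apply, Matrix.coe_reindexRingEquiv, Matrix.reindex_apply,
    Matrix.submatrix_apply, Equiv.symm_apply_apply, Matrix.comp_apply, RingHom.mapMatrix_apply,
    Matrix.map_apply]

theorem ext_block {n : ℕ} {M M' : Matrix (Fin (2 * n)) (Fin (2 * n)) ℂ}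
    (h : ∀ i j a b, M (blockIndex n (i, a)) (blockIndex n (j, b)) =
      M' (blockIndex n (i, a)) (blockIndex n (j, b))) : M = M' := by
  ext x y
  obtain ⟨⟨i, a⟩, rfl⟩ := (blockIndex n).surjective x
  obtain ⟨⟨j, b⟩, rfl⟩ := (blockIndex n).surjective y
  exact h i j a b

theorem exists_eq_checkMatrix_add {n : ℕ} (M : Matrix (Fin (2 * n)) (Fin (2 * n)) ℂ) :
    ∃ A B : Matrix (Fin n) (Fin n) ℍ[ℝ],
      M = checkMatrix n A + Complex.I • checkMatrix n B := by
  choose f g hfg using fun i j : Fin n => exists_eq_check_add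
    (Matrix.of fun a b => M (blockIndex n (i, a)) (blockIndex n (j, b)))
  refine ⟨Matrix.of f, Matrix.of g, ext_block fun i j a b => ?_⟩
  have h := congrFun (congrFun (hfg i j) a) b
  simpa [checkMatrix_apply] using h

theorem checkMatrix_add_inj {n : ℕ} {A B A' B' : Matrix (Fin n) (Fin n) ℍ[ℝ]}
    (h : checkMatrix n A + Complex.I • checkMatrix n B =
      checkMatrix n A' + Complex.I • checkMatrix n B') : A = A' ∧ B = B' := by
  have key : ∀ i j, A i j = A' i j ∧ B i j = B' i j := fun i j => by
    apply check_add_inj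
    ext a b
    have := congrFun (congrFun h (blockIndex n (i, a))) (blockIndex n (j, b))
    simpa [checkMatrix_apply] using this
  exact ⟨Matrix.ext fun i j => (key i j).1, Matrix.ext fun i j => (key i j).2⟩

theorem checkMatrix_smul {n : ℕ} (r : ℝ) (A : Matrix (Fin n) (Fin n) ℍ[ℝ]) :
    checkMatrix n (r • A) = (r : ℂ) • checkMatrix n A := by
  refine ext_block fun i j a b => ?_
  rw [checkMatrix_apply, Matrix.smul_apply, Matrix.smul_apply, checkMatrix_apply]
  fin_cases a <;> fin_cases b <;> apply Complex.ext <;> simp [check]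

/-- Write the complex inverse as `Č + i Ď`; comparing parts in `Ǔ (Č + i Ď) = 1` gives `U C = 1`. -/
theorem exists_checkGL_eq {n : ℕ} {U : Matrix (Fin n) (Fin n) ℍ[ℝ]}
    (hU : (checkMatrix n U).det ≠ 0) :
    ∃ g : Matrix.GeneralLinearGroup (Fin n) ℍ[ℝ], (checkGL n g).1 = checkMatrix n U := by
  obtain ⟨C, D, hCD⟩ := exists_eq_checkMatrix_add (checkMatrix n U)⁻¹
  have h1 : checkMatrix n U * (checkMatrix n U)⁻¹ = 1 :=
    Matrix.mul_nonsing_inv _ (isUnit_iff_ne_zero.mpr hU)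
  have h2 : checkMatrix n (U * C) + Complex.I • checkMatrix n (U * D) =
      checkMatrix n 1 + Complex.I • checkMatrix n 0 := by
    rw [map_mul, map_mul, ← mul_smul_comm, ← mul_add, ← hCD, h1, map_one, map_zero, smul_zero,
      add_zero]
  have h3 := (checkMatrix_add_inj h2).1
  exact ⟨⟨U, C, h3, mul_eq_one_comm.mp h3⟩, rfl⟩

/-- The image of `GL(n, ℍ)` is Zariski dense in the complex matrices of size `2n`. -/
theorem eq_zero_of_eval_checkGL {n : ℕ} {p : MvPolynomial (Fin (2 * n) × Fin (2 * n)) ℂ}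
    (h : ∀ g : Matrix.GeneralLinearGroup (Fin n) ℍ[ℝ],
      MvPolynomial.eval (fun ij => (checkGL n g).1 ij.1 ij.2) p = 0) : p = 0 := by
  refine eq_zero_of_eval_mul_det fun M => ?_
  obtain ⟨A, B, hM⟩ := exists_eq_checkMatrix_add M
  let P := p * (Matrix.mvPolynomialX (Fin (2 * n)) (Fin (2 * n)) ℂ).det
  -- `q(z)` is `p · det` on the line `Ǎ + z B̌`. Real `z` give quaternionic matrices, where either
  -- the determinant or `p` vanishes, so `q = 0`; then `z = i` reaches `M`.
  let q : Polynomial ℂ := MvPolynomial.eval₂ Polynomial.C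
    (fun ij => Polynomial.C (checkMatrix n A ij.1 ij.2) +
      Polynomial.X * Polynomial.C (checkMatrix n B ij.1 ij.2)) P
  have hq : ∀ z : ℂ, q.eval z =
      MvPolynomial.eval (fun ij => (checkMatrix n A + z • checkMatrix n B) ij.1 ij.2) p *
        (checkMatrix n A + z • checkMatrix n B).det := fun z => by
    have h1 : q.eval z = MvPolynomial.eval
        (fun ij => (checkMatrix n A + z • checkMatrix n B) ij.1 ij.2) P := by
      rw [← Polynomial.coe_evalRingHom, MvPolynomial.hom_eval₂]
      rw [← MvPolynomial.eval₂_id]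
      congr 1
      · ext
        all_goals simp
      · ext ij
        simp [mul_comm z]
    rw [h1, map_mul, eval_det_mvPolynomialX]
    rfl
  have hq0 : q = 0 := by
    refine Polynomial.eq_zero_of_infinite_isRoot q
      ((Set.infinite_range_of_injective Complex.ofReal_injective).mono ?_)
    rintro _ ⟨t, rfl⟩
    change q.eval (t : ℂ) = 0
    rw [hq, ← checkMatrix_smul, ← map_add]
    by_cases hd : (checkMatrix n (A + t • B)).det = 0
    · rw [hd, mul_zero]
    · obtain ⟨g, hg⟩ := exists_checkGL_eq hd
      rw [← hg, h, zero_mul]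
  rw [hM, ← hq, hq0, Polynomial.eval_zero]

/-- A rational representation of `GL(2n, ℂ)` is determined by its restriction to `GL(n, ℍ)`. -/
theorem IsRational.eq_of_checkGL {n : ℕ} {V : Type*} [AddCommGroup V] [Module ℂ V]
    {σ τ : Representation ℂ (Matrix.GeneralLinearGroup (Fin (2 * n)) ℂ) V}
    (hσ : IsRational σ) (hτ : IsRational τ)
    (h : ∀ U : Matrix.GeneralLinearGroup (Fin n) ℍ[ℝ], σ (checkGL n U) = τ (checkGL n U)) :
    σ = τ := by
  ext g v
  rw [← sub_eq_zero, ← Module.forall_dual_apply_eq_zero_iff ℂ]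
  intro l
  obtain ⟨p, k, hp⟩ := hσ l v
  obtain ⟨q, m, hq⟩ := hτ l v
  let D := (Matrix.mvPolynomialX (Fin (2 * n)) (Fin (2 * n)) ℂ).det
  have hD : ∀ g : Matrix.GeneralLinearGroup (Fin (2 * n)) ℂ,
      MvPolynomial.eval (fun ij => g.1 ij.1 ij.2) D = g.1.det := fun g =>
    eval_det_mvPolynomialX _
  have hdet : ∀ g : Matrix.GeneralLinearGroup (Fin (2 * n)) ℂ, g.1.det ≠ 0 := fun g =>
    g.det_ne_zero
  -- Clearing denominators turns the difference of the coefficients into a polynomial, to which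
  -- density applies.
  have key : ∀ g : Matrix.GeneralLinearGroup (Fin (2 * n)) ℂ,
      MvPolynomial.eval (fun ij => g.1 ij.1 ij.2) (p * D ^ m - q * D ^ k) =
        (l (σ g v) - l (τ g v)) * (g.1.det ^ k * g.1.det ^ m) := fun g => by
    have := hdet g
    rw [hp, hq, map_sub, map_mul, map_mul, map_pow, map_pow, hD]
    field_simp
  have h0 : p * D ^ m - q * D ^ k = 0 := eq_zero_of_eval_checkGL fun U => by
    rw [key, h, sub_self, zero_mul]
  have hg := key g
  rw [h0, map_zero] at hg
  rw [map_sub]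
  exact (mul_eq_zero.mp hg.symm).resolve_right
    (mul_ne_zero (pow_ne_zero _ (hdet g)) (pow_ne_zero _ (hdet g)))

/-! ### Hermitian quaternionic matrices and skew-symmetric complex matrices -/

/-- The quaternion unit `i₂`. -/
def quatJ : ℍ[ℝ] := ⟨0, 0, 1, 0⟩

@[simp]
theorem quatJ_re : quatJ.re = 0 := rfl

@[simp]
theorem quatJ_imI : quatJ.imI = 0 := rfl

@[simp]
theorem quatJ_imJ : quatJ.imJ = 1 := rfl

@[simp]
theorem quatJ_imK : quatJ.imK = 0 := rfl

theorem quatJ_mul_self : quatJ * quatJ = -1 := by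
  ext <;> simp

theorem star_quatJ : star quatJ = -quatJ := by
  ext <;> simp

/-- The scalar matrix with the quaternion unit `i₂` on the diagonal. -/
def scalarJ (n : ℕ) : Matrix (Fin n) (Fin n) ℍ[ℝ] := Matrix.diagonal fun _ => quatJ

theorem scalarJ_mul_self (n : ℕ) : scalarJ n * scalarJ n = -1 := by
  simp only [scalarJ, Matrix.diagonal_mul_diagonal, quatJ_mul_self]
  rw [← Matrix.diagonal_one, Matrix.diagonal_neg]

theorem conjTranspose_scalarJ (n : ℕ) : (scalarJ n).conjTranspose = -scalarJ n := by
  rw [scalarJ, Matrix.diagonal_conjTranspose, Matrix.diagonal_neg]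
  exact congrArg Matrix.diagonal (funext fun _ => star_quatJ)

theorem transpose_checkMatrix {n : ℕ} (A : Matrix (Fin n) (Fin n) ℍ[ℝ]) :
    (checkMatrix n A).transpose = checkMatrix n (-(scalarJ n * A.conjTranspose * scalarJ n)) := by
  refine ext_block fun i j a b => ?_
  rw [Matrix.transpose_apply, checkMatrix_apply, checkMatrix_apply, Matrix.neg_apply, scalarJ,
    Matrix.mul_diagonal, Matrix.diagonal_mul, Matrix.conjTranspose_apply]
  fin_cases a <;> fin_cases b <;> apply Complex.ext <;> simp [check]

/-- The real linear embedding `W ↦ W̌ 𝒥⁻¹` of the hermitian quaternionic matrices into the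
skew-symmetric complex matrices. -/
def hermToSkew (n : ℕ) : HermX n →ₗ[ℝ] skew (2 * n) where
  toFun W := ⟨checkMatrix n (W.1 * scalarJ n), by
    have hW : W.1.conjTranspose = W.1 := W.2
    rw [mem_skew, transpose_checkMatrix, ← map_neg, Matrix.conjTranspose_mul,
      conjTranspose_scalarJ, hW, ← mul_assoc, mul_neg, scalarJ_mul_self, neg_neg, one_mul]⟩
  map_add' V W := by
    apply Subtype.ext
    simp [add_mul]
  map_smul' r W := by
    apply Subtype.ext
    change checkMatrix n ((r • W.1) * scalarJ n) = (r : ℂ) • checkMatrix n (W.1 * scalarJ n)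
    rw [Matrix.smul_mul, checkMatrix_smul]

theorem hermToSkew_conjX {n : ℕ} (U : Matrix (Fin n) (Fin n) ℍ[ℝ]) (W : HermX n) :
    hermToSkew n (conjX n U W) = skewConj (2 * n) (checkMatrix n U) (hermToSkew n W) := by
  apply Subtype.ext
  change checkMatrix n (U * W.1 * U.conjTranspose * scalarJ n) =
    checkMatrix n U * checkMatrix n (W.1 * scalarJ n) * (checkMatrix n U).transpose
  rw [transpose_checkMatrix, ← map_mul, ← map_mul]
  congr 1
  have h : scalarJ n * (scalarJ n * (U.conjTranspose * scalarJ n)) =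
      -(U.conjTranspose * scalarJ n) := by
    rw [← mul_assoc, scalarJ_mul_self, neg_one_mul]
  simp only [mul_assoc, mul_neg, h, neg_neg]

/-- The complex linear extension of `hermToSkew`. -/
def complexToSkew (n : ℕ) : ComplexZ n →ₗ[ℂ] skew (2 * n) := (hermToSkew n).liftBaseChange ℂ

theorem complexToSkew_tmul {n : ℕ} (z : ℂ) (W : HermX n) :
    complexToSkew n (z ⊗ₜ W) = z • hermToSkew n W := by
  simp [complexToSkew]

theorem exists_eq_one_tmul_add {V : Type*} [AddCommGroup V] [Module ℝ V] (x : ℂ ⊗[ℝ] V) :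
    ∃ v w : V, x = (1 : ℂ) ⊗ₜ[ℝ] v + Complex.I ⊗ₜ[ℝ] w := by
  induction x using TensorProduct.induction_on with
  | zero => exact ⟨0, 0, by simp⟩
  | tmul z v =>
    refine ⟨z.re • v, z.im • v, ?_⟩
    rw [← TensorProduct.smul_tmul, ← TensorProduct.smul_tmul, ← TensorProduct.add_tmul]
    congr 1
    apply Complex.ext <;> simp
  | add x y hx hy =>
    obtain ⟨v, w, rfl⟩ := hx
    obtain ⟨v', w', rfl⟩ := hy
    refine ⟨v + v', w + w', ?_⟩
    rw [TensorProduct.tmul_add, TensorProduct.tmul_add]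
    abel

theorem coe_complexToSkew {n : ℕ} (A B : HermX n) :
    (complexToSkew n ((1 : ℂ) ⊗ₜ[ℝ] A + Complex.I ⊗ₜ[ℝ] B)).1 =
      checkMatrix n (A.1 * scalarJ n) + Complex.I • checkMatrix n (B.1 * scalarJ n) := by
  rw [map_add, complexToSkew_tmul, complexToSkew_tmul, one_smul]
  rfl

theorem complexToSkew_injective (n : ℕ) : Function.Injective (complexToSkew n) := by
  rw [injective_iff_map_eq_zero]
  intro x hx
  obtain ⟨A, B, rfl⟩ := exists_eq_one_tmul_add x
  have h : checkMatrix n (A.1 * scalarJ n) + Complex.I • checkMatrix n (B.1 * scalarJ n) =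
      checkMatrix n 0 + Complex.I • checkMatrix n 0 := by
    rw [← coe_complexToSkew, hx]
    simp
  have hz : ∀ C : HermX n, C.1 * scalarJ n = 0 → C = 0 := fun C hC => by
    apply Subtype.ext
    have := congrArg (· * scalarJ n) hC
    simpa [mul_assoc, scalarJ_mul_self] using this
  obtain ⟨hA, hB⟩ := checkMatrix_add_inj h
  rw [hz A hA, hz B hB, TensorProduct.tmul_zero, TensorProduct.tmul_zero, add_zero]

theorem complexToSkew_surjective (n : ℕ) : Function.Surjective (complexToSkew n) := by
  intro S
  obtain ⟨A, B, hS⟩ := exists_eq_checkMatrix_add S.1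
  have h := mem_skew.mp S.2
  rw [hS, Matrix.transpose_add, Matrix.transpose_smul, transpose_checkMatrix,
    transpose_checkMatrix, neg_add, ← smul_neg, ← map_neg, ← map_neg] at h
  -- Since `J⁻¹ = -J`, the preimage of `Č` must be `-(C J)`.
  have hherm : ∀ C : Matrix (Fin n) (Fin n) ℍ[ℝ],
      -(scalarJ n * C.conjTranspose * scalarJ n) = -C → -(C * scalarJ n) ∈ HermX n := fun C hC => by
    change (-(C * scalarJ n)).conjTranspose = -(C * scalarJ n)
    rw [Matrix.conjTranspose_neg, Matrix.conjTranspose_mul, conjTranspose_scalarJ]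
    have := congrArg (· * scalarJ n) hC
    simpa [mul_assoc, scalarJ_mul_self] using this
  obtain ⟨hA, hB⟩ := checkMatrix_add_inj h
  refine ⟨(1 : ℂ) ⊗ₜ[ℝ] ⟨_, hherm A hA⟩ + Complex.I ⊗ₜ[ℝ] ⟨_, hherm B hB⟩, Subtype.ext ?_⟩
  rw [coe_complexToSkew, hS]
  simp [mul_assoc, scalarJ_mul_self]

/-- The identification of `𝒵ₙ` with the skew-symmetric complex matrices of size `2n`. -/
def complexEquivSkew (n : ℕ) : ComplexZ n ≃ₗ[ℂ] skew (2 * n) :=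
  LinearEquiv.ofBijective (complexToSkew n)
    ⟨complexToSkew_injective n, complexToSkew_surjective n⟩

theorem isJac_skewRep (n : ℕ) : IsJac n (skewRep (complexEquivSkew n)) where
  rational := isRational_skewRep _
  extends_rho U := by
    refine LinearMap.ext fun x => (complexEquivSkew n).injective ?_
    rw [apply_skewRep]
    change skewConj (2 * n) (checkMatrix n U.1) (complexToSkew n x) = complexToSkew n (rho n U x)
    induction x using TensorProduct.induction_on with
    | zero => simp
    | tmul z W =>
      change _ = complexToSkew n (z ⊗ₜ conjX n U.1 W)
      rw [complexToSkew_tmul, complexToSkew_tmul, map_smul, hermToSkew_conjX]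
    | add x y hx hy => simp only [map_add, hx, hy]

theorem finrank_complexZ (n : ℕ) : Module.finrank ℂ (ComplexZ n) = n + 2 * n * (n - 1) := by
  rw [(complexEquivSkew n).finrank_eq, finrank_skew, Nat.choose_two_right]
  -- The case `n = 0` is separate because subtraction in `ℕ` is truncated.
  rcases n with _ | m
  · rfl
  · have : 2 * (m + 1) * (2 * (m + 1) - 1) = 2 * ((m + 1) + 2 * (m + 1) * (m + 1 - 1)) := by
      simp only [Nat.add_sub_cancel, show 2 * (m + 1) - 1 = 2 * m + 1 by omega]
      ring
    omega

end QuatJac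

end

theorem lemma5p3 (n : ℕ) (hn : 1 ≤ n) :
    ∃ rhoJac : Representation ℂ (Matrix.GeneralLinearGroup (Fin (2 * n)) ℂ) (QuatJac.ComplexZ n),
      (QuatJac.IsJac n rhoJac ∧ ∀ σ, QuatJac.IsJac n σ → σ = rhoJac) ∧
      Module.finrank ℂ (QuatJac.ComplexZ n) = n + 2 * n * (n - 1) ∧
      rhoJac.IsIrreducible ∧
      QuatJac.IsHighestWeight rhoJac (fun i => if i.val < 2 then 1 else 0) := by
  have hJ := QuatJac.isJac_skewRep n
  refine ⟨_, ⟨hJ, fun σ hσ => ?_⟩, QuatJac.finrank_complexZ n,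
    QuatJac.isIrreducible_skewRep (by omega) _, QuatJac.isHighestWeight_skewRep (by omega) _⟩
  exact hσ.rational.eq_of_checkGL hJ.rational fun U => by
    rw [hσ.extends_rho, hJ.extends_rho]
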